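/- **Proposition (Existence of ESR-NE / SER-NE).** Consider a finite-horizon $N$-player multi-objective Markov game with horizon $H$, finite state space $\mathcal S$, fixed initial state $s_1$, finite non-empty action sets $\mathcal A_1,\dots,\mathcal A_N$, joint actions $\bm a\in\mathcal A=\prod_i\mathcal A_i$, transition kernels $P_h:\mathcal S\times\mathcal A\to\Delta(\mathcal S)$ and vector rewards $\bm r_{k,h}(s,\bm a)\in[0,1]^M$ for each agent $k$ and step $h=1,\dots,H$. A policy of agent $k$ is a family $\pi_k=(\pi_{k,h})_{h=1}^H$ of maps $\pi_{k,h}:\mathcal S\to\Delta(\mathcal A_k)$. Under a product policy $\bm\pi=(\pi_1,\dots,\pi_N)$ the agents choose their actions independently, $a_{k,h}\sim\pi_{k,h}(\cdot\mid s_h)$, and $s_{h+1}\sim P_h(\cdot\mid s_h,\bm a_h)$. For a real- or vector-valued reward $r$ let $$V^{\bm\pi}_{r}(s_1)=\mathbb E_{\bm\pi,P}\Big[\sum_{h=1}^{H} r_h(s_h,\bm a_h)\,\Big|\, s_1\Big].$$ Each agent $k$ has a utility function $u_k:\mathbb R^M\to\mathbb R$. A product policy $\bm\pi^*$ is an *expected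 scalarized return Nash equilibrium (ESR-NE)* if it is a Nash equilibrium of the single-objective Markov game with rewards $\bar r_{k,h}=u_k(\bm r_{k,h})$, that is, if for every agent $k$ and every policy $\pi_k$ $$V^{(\pi_k,\bm\pi^*_{-k})}_{\bar r_k}(s_1)\le V^{\bm\pi^*}_{\bar r_k}(s_1),$$ and a *scalarized expected return Nash equilibrium (SER-NE)* if for every agent $k$ and every policy $\pi_k$ $$u_k\big(V^{(\pi_k,\bm\pi^*_{-k})}_{\bm r_k}(s_1)\big)\le u_k\big(V^{\bm\pi^*}_{\bm r_k}(s_1)\big).$$ 1. For every such game and all utility functions $u_1,\dots,u_N$, an ESR-NE exists. 2. An SER-NE need not exist: there are such a game and utility functions $u_1,\dots,u_N$, which can even be taken continuous, for which no SER-NE exists. 3. For every such game, if every $u_k$ is continuous and quasi-concave on $\mathbb R^M$, then an SER-NE exists. -/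

import Mathlib

universe u v

/-- A joint action: one action for each of the `N` agents. -/
abbrev JointAction {N : ℕ} (A : Fin N → Type v) : Type v := ∀ i, A i

/-- A (time-inhomogeneous) transition kernel: `P h s a` is the law of the next state when the joint
action `a` is taken in state `s` at step `h`. The `H` steps are indexed by `Fin H`, so the first
step has index `0`. -/
abbrev TransitionKernel {N : ℕ} (S : Type u) [Fintype S] (A : Fin N → Type v) (H : ℕ) :
    Type (max u v) :=
  Fin H → S → JointAction A → stdSimplex ℝ S

/-- A stochastic Markov policy of an agent with action set `B`: for each step and each state, a
probability distribution on the agent's actions. -/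
abbrev AgentPolicy (S : Type u) (B : Type v) [Fintype B] (H : ℕ) : Type (max u v) :=
  Fin H → S → stdSimplex ℝ B

/-- A product policy: a profile of policies, one for each agent (the agents randomize
independently). -/
abbrev ProductPolicy {N : ℕ} (S : Type u) (A : Fin N → Type v) [∀ i, Fintype (A i)] (H : ℕ) :
    Type (max u v) :=
  ∀ i, AgentPolicy S (A i) H

section Value

variable {N H : ℕ} {S : Type u} [Fintype S] {A : Fin N → Type v} [∀ i, Fintype (A i)]

/-- The probability that the product policy `π` chooses the joint action `a` at step `h` in
state `s`. -/
def jointProb (π : ProductPolicy S A H) (h : Fin H) (s : S) (a : JointAction A) : ℝ :=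
  ∏ i, π i h s (a i)

open Classical in
/-- The probability of the trajectory with states `σ 0, …, σ H` and joint actions
`α 0, …, α (H - 1)` when play starts in `s₁` and follows `π`. -/
noncomputable def trajProb (P : TransitionKernel S A H) (π : ProductPolicy S A H) (s₁ : S)
    (σ : Fin (H + 1) → S) (α : Fin H → JointAction A) : ℝ :=
  (if σ 0 = s₁ then 1 else 0) *
    ∏ h : Fin H, jointProb π h (σ h.castSucc) (α h) * P h (σ h.castSucc) (α h) (σ h.succ)

/-- The value at the first step from state `s₁`, for the scalar reward function `r`: the expected
total reward over the `H` steps under the law of the trajectory. -/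
noncomputable def value (P : TransitionKernel S A H) (π : ProductPolicy S A H) (s₁ : S)
    (r : Fin H → S → JointAction A → ℝ) : ℝ :=
  ∑ σ : Fin (H + 1) → S, ∑ α : Fin H → JointAction A,
    trajProb P π s₁ σ α * ∑ h : Fin H, r h (σ h.castSucc) (α h)

end Value

/-- A finite-horizon `N`-player single-objective Markov game. Rewards are real numbers, without a
range restriction, since scalarized rewards may take any real value. -/
structure SMG (N : ℕ) (S : Type u) [Fintype S] (A : Fin N → Type v) (H : ℕ) where
  P : TransitionKernel S A H
  r : Fin N → Fin H → S → JointAction A → ℝ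

/-- The product policy `π` is a Nash equilibrium (from the initial state `s₁`): no agent can
increase its value by a unilateral change of its own policy. -/
def SMG.IsNE {N H : ℕ} {S : Type u} [Fintype S] {A : Fin N → Type v} [∀ i, Fintype (A i)]
    (G : SMG N S A H) (s₁ : S) (π : ProductPolicy S A H) : Prop :=
  ∀ (k : Fin N) (πk : AgentPolicy S (A k) H),
    value G.P (Function.update π k πk) s₁ (G.r k) ≤ value G.P π s₁ (G.r k)

/-- A finite-horizon `N`-player general-sum multi-objective Markov game with `M` objectives:
each agent receives a reward vector in `[0,1]^M` at each step. -/
structure MOMG (N : ℕ) (S : Type u) [Fintype S] (A : Fin N → Type v) (M H : ℕ) where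
  P : TransitionKernel S A H
  r : Fin N → Fin H → S → JointAction A → Fin M → ℝ
  r_mem : ∀ k h s a m, r k h s a m ∈ Set.Icc (0 : ℝ) 1

namespace MOMG

variable {N M H : ℕ} {S : Type u} [Fintype S] {A : Fin N → Type v}

/-- The vector-valued value of agent `k` at the first step from state `s₁`. -/
noncomputable def vectorValue [∀ i, Fintype (A i)] (G : MOMG N S A M H) (k : Fin N)
    (π : ProductPolicy S A H) (s₁ : S) : Fin M → ℝ :=
  fun m => value G.P π s₁ (fun h s a => G.r k h s a m)

/-- The single-objective Markov game in which agent `k` receives the scalarized reward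
`u k (r k h s a)`. -/
def scalarize (G : MOMG N S A M H) (u : Fin N → (Fin M → ℝ) → ℝ) : SMG N S A H where
  P := G.P
  r := fun k h s a => u k (G.r k h s a)

/-- Expected scalarized return Nash equilibrium. -/
def IsESRNE [∀ i, Fintype (A i)] (G : MOMG N S A M H) (u : Fin N → (Fin M → ℝ) → ℝ) (s₁ : S)
    (π : ProductPolicy S A H) : Prop :=
  (G.scalarize u).IsNE s₁ π

/-- Scalarized expected return Nash equilibrium. -/
def IsSERNE [∀ i, Fintype (A i)] (G : MOMG N S A M H) (u : Fin N → (Fin M → ℝ) → ℝ) (s₁ : S)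
    (π : ProductPolicy S A H) : Prop :=
  ∀ (k : Fin N) (πk : AgentPolicy S (A k) H),
    u k (G.vectorValue k (Function.update π k πk) s₁) ≤ u k (G.vectorValue k π s₁)

end MOMG

/-! The value is not linear in an agent's policy, but it is linear in the occupancies. If agent `k`,
with the others fixed, mixes policies `ρ j` at each state and step in proportion to `c j` times the
probability that `ρ j` visits that state, its vector value is the `c`-mean of theirs
(`value_eq_sum_of_mix`).

Given finitely many deviations, move each agent's policy towards them with weights gain times visit
probability, the gain being the positive part of the utility increase. This Nash map is continuous,
so Brouwer gives a fixed point, where the policy is itself such a mixture. If some gain were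
positive, the agent's vector value would be a convex combination of vectors of strictly larger
utility, which quasi-concavity forbids (`exists_forall_update_le_of_fintype`). Compactness of the
policy space then handles all deviations at once. ESR is the case of one objective with a linear
utility.

Brouwer follows from the absence of a smooth retraction onto the sphere, by a volume argument. For
the counterexample, utilities of marginal probabilities reproduce a pursuit game without pure
equilibrium. -/

/-! ### Brouwer's fixed point theorem -/

open Metric MeasureTheory in
/-- The determinant of `1 + A` is a fixed affine combination of the determinants of `1 + tᵢ • A`
for finitely many arbitrarily small positive `tᵢ`. -/
theorem ContinuousLinearMap.exists_det_one_add_eq_sum {E : Type*} [NormedAddCommGroup E]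
    [NormedSpace ℝ E] [FiniteDimensional ℝ E] {δ : ℝ} (hδ : 0 < δ) :
    ∃ (n : ℕ) (c t : Fin n → ℝ), (∀ i, 0 < t i ∧ t i < δ) ∧ ∑ i, c i = 1 ∧
      ∀ A : E →L[ℝ] E, (1 + A).det = ∑ i, c i * (1 + t i • A).det := by
  set b := Module.finBasis ℝ E
  set n := Module.finrank ℝ E
  -- `det (1 + x • A)` has degree at most `n` in `x`, so its value at `1` is interpolated from any
  -- `n + 1` distinct nodes. The shift by `2` keeps every node below `δ`.
  set t : Fin (n + 1) → ℝ := fun i => δ / (i + 2)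
  have ht : Set.InjOn t (Finset.univ : Finset (Fin (n + 1))) := by
    intro i _ j _ hij
    have hi : (0 : ℝ) < i + 2 := by positivity
    have hj : (0 : ℝ) < j + 2 := by positivity
    simp only [t] at hij
    rw [div_eq_div_iff hi.ne' hj.ne'] at hij
    have := mul_left_cancel₀ hδ.ne' hij
    ext
    have : (j : ℝ) = i := by linarith
    exact_mod_cast this.symm
  refine ⟨n + 1, fun i => (Lagrange.basis Finset.univ t i).eval 1, t, fun i => ⟨by positivity, ?_⟩,
    ?_, fun A => ?_⟩
  · simp only [t]
    rw [div_lt_iff₀ (by positivity)]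
    have : (0 : ℝ) ≤ i := by positivity
    nlinarith
  · rw [← Polynomial.eval_finsetSum, Lagrange.sum_basis ht Finset.univ_nonempty]
    simp
  · set M := LinearMap.toMatrix b b (A : E →ₗ[ℝ] E)
    set p : Polynomial ℝ := ((Polynomial.X : Polynomial ℝ) • M.map Polynomial.C +
      (1 : Matrix (Fin n) (Fin n) ℝ).map Polynomial.C).det
    have hp : ∀ x : ℝ, p.eval x = (1 + x • A).det := by
      intro x
      rw [ContinuousLinearMap.det, ← LinearMap.det_toMatrix b, ← Polynomial.coe_evalRingHom,
        RingHom.map_det]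
      congr 1
      ext i j
      have hx : LinearMap.toMatrix b b ((1 + x • A : E →L[ℝ] E) : E →ₗ[ℝ] E) = 1 + x • M := by
        rw [← LinearMap.toMatrix_one b, ← map_smul, ← map_add]
        rfl
      rw [hx]
      simp only [RingHom.mapMatrix_apply, Matrix.map_apply, Matrix.add_apply, Matrix.smul_apply,
        smul_eq_mul, Polynomial.coe_evalRingHom, Polynomial.eval_add, Polynomial.eval_mul,
        Polynomial.eval_X, Polynomial.eval_C]
      ring
    have hdeg : p.degree < (Finset.univ : Finset (Fin (n + 1))).card := by
      refine lt_of_le_of_lt Polynomial.degree_le_natDegree ?_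
      have := Polynomial.natDegree_det_X_add_C_le M 1
      simp only [Fintype.card_fin] at this
      simp only [Finset.card_univ, Fintype.card_fin]
      exact_mod_cast Nat.lt_succ_of_le this
    have h1 := congrArg (Polynomial.eval 1) (Lagrange.eq_interpolate ht hdeg)
    rw [hp, one_smul] at h1
    rw [h1, Lagrange.interpolate_apply, Polynomial.eval_finsetSum]
    refine Finset.sum_congr rfl fun i _ => ?_
    rw [Polynomial.eval_mul, Polynomial.eval_C, hp, mul_comm]

section

variable {E : Type*} [NormedAddCommGroup E] [NormedSpace ℝ E]

open Metric

/-- A displacement of the closed unit ball that vanishes on the sphere and is Lipschitz there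
extends by zero to a Lipschitz map. -/
theorem lipschitzWith_indicator_closedBall {h : E → E} {C : NNReal}
    (hL : LipschitzOnWith C h (closedBall 0 1)) (h0 : ∀ x, ‖x‖ = 1 → h x = 0) :
    LipschitzWith (2 * C) ((closedBall (0 : E) 1).indicator h) := by
  -- Compare `x` with the radial projection `z` of `y`, where `h` vanishes; `‖y - z‖ = ‖y‖ - 1 ≤ ‖x
  -- - y‖` produces the factor `2`.
  have key : ∀ x y : E, ‖x‖ ≤ 1 → 1 < ‖y‖ → ‖h x‖ ≤ 2 * C * ‖x - y‖ := by
    intro x y hx hy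
    have hy0 : ‖y‖ ≠ 0 := by positivity
    set z := ‖y‖⁻¹ • y
    have hz : ‖z‖ = 1 := by simp [z, norm_smul, hy0]
    have h1 := hL.norm_sub_le (mem_closedBall_zero_iff.2 hx) (mem_closedBall_zero_iff.2 hz.le)
    rw [h0 z hz, sub_zero] at h1
    have h2 : ‖y - z‖ = ‖y‖ - 1 := by
      have : y - z = (1 - ‖y‖⁻¹) • y := by simp [z, sub_smul]
      rw [this, norm_smul, Real.norm_of_nonneg, sub_mul, inv_mul_cancel₀ hy0, one_mul]
      rw [sub_nonneg]; exact inv_le_one_of_one_le₀ hy.le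
    have h3 : ‖y‖ - ‖x‖ ≤ ‖x - y‖ := by rw [norm_sub_rev]; exact norm_sub_norm_le y x
    have h4 : ‖x - z‖ ≤ ‖x - y‖ + ‖y - z‖ := norm_sub_le_norm_sub_add_norm_sub x y z
    calc ‖h x‖ ≤ C * ‖x - z‖ := h1
      _ ≤ C * (2 * ‖x - y‖) := by gcongr; linarith
      _ = _ := by ring
  refine LipschitzWith.of_dist_le_mul fun x y => ?_
  rw [dist_eq_norm, dist_eq_norm]
  push_cast
  by_cases hx : x ∈ closedBall (0 : E) 1 <;> by_cases hy : y ∈ closedBall (0 : E) 1 <;>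
    simp only [hx, hy, Set.indicator_of_mem, Set.indicator_of_notMem, not_false_eq_true, sub_zero,
      zero_sub, norm_neg, sub_self, norm_zero]
  · refine (hL.norm_sub_le hx hy).trans ?_
    have : 0 ≤ C * ‖x - y‖ := by positivity
    linarith
  · simp only [mem_closedBall_zero_iff, not_le] at hx hy
    exact key x y hx hy
  · simp only [mem_closedBall_zero_iff, not_le] at hx hy
    rw [norm_sub_rev]
    exact key y x hy hx
  · positivity

/-- Small multiples of a Lipschitz displacement of the closed unit ball which vanishes on the
sphere and points into the ball move the open ball bijectively onto itself. -/
theorem injOn_and_image_ball_of_lipschitz [CompleteSpace E] {h : E → E} {C : NNReal}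
    (hL : LipschitzOnWith C h (closedBall 0 1)) (h0 : ∀ x, ‖x‖ = 1 → h x = 0)
    (h1 : ∀ x, ‖x‖ ≤ 1 → ‖x + h x‖ ≤ 1) {t : ℝ} (ht0 : 0 < t) (ht1 : t < 1)
    (htC : t * (2 * C) < 1) :
    Set.InjOn (fun x => x + t • h x) (ball 0 1) ∧
      (fun x => x + t • h x) '' ball 0 1 = ball 0 1 := by
  set F := (closedBall (0 : E) 1).indicator h
  have hF := lipschitzWith_indicator_closedBall hL h0
  have hmem : ∀ x, ‖x‖ ≤ 1 → F x = h x := fun x hx =>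
    Set.indicator_of_mem (mem_closedBall_zero_iff.2 hx) h
  have hnot : ∀ x, 1 < ‖x‖ → F x = 0 := fun x hx =>
    Set.indicator_of_notMem (by simpa using hx) h
  -- Solving `x + t • F x = y` is a fixed point problem for a contraction: uniqueness gives
  -- injectivity, existence gives surjectivity.
  have hcontr : ∀ y : E, ContractingWith (t.toNNReal * (2 * C)) (fun x => y - t • F x) := by
    intro y
    refine ⟨?_, LipschitzWith.of_dist_le_mul fun a b => ?_⟩
    · rw [← NNReal.coe_lt_coe]; simpa [ht0.le] using htC
    · have := hF.dist_le_mul a b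
      rw [dist_eq_norm] at this ⊢
      have e : y - t • F a - (y - t • F b) = - (t • (F a - F b)) := by rw [smul_sub]; abel
      rw [e, norm_neg, norm_smul, Real.norm_of_nonneg ht0.le]
      push_cast [Real.coe_toNNReal _ ht0.le] at this ⊢
      rw [mul_assoc]
      gcongr
  constructor
  · intro x hx x' hx' hxx
    simp only at hxx
    rw [mem_ball_zero_iff] at hx hx'
    rw [← hmem x hx.le, ← hmem x' hx'.le] at hxx
    refine (hcontr (x + t • F x)).fixedPoint_unique' ?_ ?_
    · simp [Function.IsFixedPt]
    · simp [Function.IsFixedPt, hxx]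
  · apply Set.Subset.antisymm
    · rintro _ ⟨x, hx, rfl⟩
      rw [mem_ball_zero_iff] at hx ⊢
      have e : x + t • h x = (1 - t) • x + t • (x + h x) := by
        rw [smul_add, sub_smul, one_smul]; abel
      simp only
      rw [e]
      refine (norm_add_le _ _).trans_lt ?_
      rw [norm_smul, norm_smul, Real.norm_of_nonneg ht0.le, Real.norm_of_nonneg (by linarith)]
      have := h1 x hx.le
      nlinarith
    · intro y hy
      rw [mem_ball_zero_iff] at hy
      have hfix := (hcontr y).fixedPoint_isFixedPt
      set x := ContractingWith.fixedPoint _ (hcontr y)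
      have hxy : x + t • F x = y := by
        have : y - t • F x = x := hfix
        nth_rw 1 [← this]
        exact sub_add_cancel y _
      -- On and outside the sphere `F` vanishes, so the solution would be `y` itself, which lies
      -- inside.
      have hx : ‖x‖ < 1 := by
        by_contra hx
        rcases (not_lt.1 hx).lt_or_eq with hx | hx
        · rw [hnot x hx, smul_zero, add_zero] at hxy
          rw [hxy] at hx; linarith
        · rw [hmem x hx.ge, h0 x hx.symm, smul_zero, add_zero] at hxy
          rw [hxy] at hx; linarith
      refine ⟨x, mem_ball_zero_iff.2 hx, ?_⟩
      simp only
      rw [← hmem x hx.le, hxy]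

end

open Metric MeasureTheory in
/-- There is no continuously differentiable retraction of the closed unit ball onto its boundary;
the retraction is written `x ↦ x + h x`. -/
theorem no_contDiff_retraction {E : Type*} [NormedAddCommGroup E]
    [InnerProductSpace ℝ E] [FiniteDimensional ℝ E] {h : E → E} {U : Set E} (hU : IsOpen U)
    (hBU : closedBall (0 : E) 1 ⊆ U) (hh : ContDiffOn ℝ 1 h U) (h0 : ∀ x, ‖x‖ = 1 → h x = 0)
    (h1 : ∀ x, ‖x‖ ≤ 1 → ‖x + h x‖ = 1) : False := by
  borelize E
  have hd : ∀ x ∈ closedBall (0 : E) 1, DifferentiableAt ℝ h x := fun x hx =>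
    (hh.differentiableOn one_ne_zero).differentiableAt (hU.mem_nhds (hBU hx))
  have hcont : ContinuousOn (fderiv ℝ h) (closedBall 0 1) :=
    (hh.continuousOn_fderiv_of_isOpen hU le_rfl).mono hBU
  obtain ⟨C, hC⟩ := (isCompact_closedBall (0 : E) 1).exists_bound_of_continuousOn hcont
  have hC0 : 0 ≤ C := (norm_nonneg _).trans (hC 0 (by simp))
  have hL : LipschitzOnWith C.toNNReal h (closedBall 0 1) :=
    (convex_closedBall (0 : E) 1).lipschitzOnWith_of_nnnorm_fderiv_le hd fun x hx => by
      rw [← NNReal.coe_le_coe]; simpa [hC0] using hC x hx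
  obtain ⟨η, hη, hdet⟩ : ∃ η > 0, ∀ A : E →L[ℝ] E, ‖A‖ < η → 0 < (1 + A).det := by
    have hc : Continuous fun A : E →L[ℝ] E => (1 + A).det :=
      ContinuousLinearMap.continuous_det.comp (by fun_prop)
    have : ∀ᶠ A in nhds (0 : E →L[ℝ] E), 0 < (1 + A).det :=
      (hc.tendsto 0).eventually_const_lt (by simp [ContinuousLinearMap.det])
    obtain ⟨η, hη, H⟩ := Metric.eventually_nhds_iff.1 this
    exact ⟨η, hη, fun A hA => H (by simpa using hA)⟩
  -- The three bounds keep the image in the ball, make the inverse problem a contraction, and keep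
  -- the Jacobian determinant positive.
  set δ := min 1 (min (1 / (2 * C + 1)) (η / (C + 1)))
  have hδ : 0 < δ := by positivity
  obtain ⟨n, c, t, ht, hc, hsum⟩ := ContinuousLinearMap.exists_det_one_add_eq_sum (E := E) hδ
  set V : ℝ := ∫ _ in ball (0 : E) 1, (1 : ℝ)
  have hV : 0 < V := by
    simp only [V, integral_const, smul_eq_mul, mul_one, measureReal_restrict_apply_univ]
    exact ENNReal.toReal_pos (measure_ball_pos _ _ one_pos).ne' measure_ball_lt_top.ne
  have hint : ∀ s : ℝ, IntegrableOn (fun x => (1 + s • fderiv ℝ h x).det) (ball (0 : E) 1) := by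
    intro s
    refine IntegrableOn.mono_set (ContinuousOn.integrableOn_compact
      (isCompact_closedBall (0 : E) 1) ?_) ball_subset_closedBall
    exact ContinuousLinearMap.continuous_det.comp_continuousOn
      (continuousOn_const.add (hcont.const_smul s))
  have hvol : ∀ i, ∫ x in ball (0 : E) 1, (1 + t i • fderiv ℝ h x).det = V := by
    intro i
    obtain ⟨ht0, htδ⟩ := ht i
    have a1 : t i < 1 := htδ.trans_le (min_le_left _ _)
    have a2 : t i < 1 / (2 * C + 1) :=
      htδ.trans_le ((min_le_right _ _).trans (min_le_left _ _))
    have a3 : t i < η / (C + 1) := htδ.trans_le ((min_le_right _ _).trans (min_le_right _ _))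
    rw [lt_div_iff₀ (by positivity)] at a2 a3
    obtain ⟨hinj, himg⟩ := injOn_and_image_ball_of_lipschitz hL h0 (fun x hx => (h1 x hx).le)
      ht0 a1 (by rw [Real.coe_toNNReal _ hC0]; nlinarith)
    have hder : ∀ x ∈ ball (0 : E) 1, HasFDerivWithinAt (fun x => x + t i • h x)
        (1 + t i • fderiv ℝ h x) (ball 0 1) x := fun x hx =>
      ((hasFDerivAt_id x).add
        ((hd x (ball_subset_closedBall hx)).hasFDerivAt.const_smul (t i))).hasFDerivWithinAt
    have key := integral_image_eq_integral_abs_det_fderiv_smul volume measurableSet_ball hder hinj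
      (fun _ => (1 : ℝ))
    rw [himg] at key
    rw [show V = _ from key]
    refine setIntegral_congr_fun measurableSet_ball fun x hx => ?_
    have hpos : 0 < (1 + t i • fderiv ℝ h x).det := by
      apply hdet
      rw [norm_smul, Real.norm_of_nonneg ht0.le]
      have := hC x (ball_subset_closedBall hx)
      nlinarith
    simp [abs_of_pos hpos]
  -- Differentiating `‖x + h x‖ ^ 2 = 1` shows that the range of the derivative is orthogonal to the
  -- nonzero vector `x + h x`.
  have hzero : ∀ x ∈ ball (0 : E) 1, (1 + fderiv ℝ h x).det = 0 := by
    intro x hx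
    have hder : HasFDerivAt (fun x => x + h x) (1 + fderiv ℝ h x) x :=
      (hasFDerivAt_id x).add (hd x (ball_subset_closedBall hx)).hasFDerivAt
    have hsq := hder.norm_sq
    have hconst : (fun y => ‖y + h y‖ ^ 2) =ᶠ[nhds x] fun _ => (1 : ℝ) := by
      filter_upwards [isOpen_ball.mem_nhds hx] with y hy
      rw [h1 y (by simpa using (mem_ball_zero_iff.1 hy).le), one_pow]
    have h2 := hsq.unique ((hasFDerivAt_const (1 : ℝ) x).congr_of_eventuallyEq hconst)
    by_contra hne
    have hunit : IsUnit (LinearMap.det ((1 + fderiv ℝ h x : E →L[ℝ] E) : E →ₗ[ℝ] E)) :=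
      isUnit_iff_ne_zero.2 hne
    have hsurj : Function.Surjective (1 + fderiv ℝ h x : E →L[ℝ] E) := by
      have := ((Module.End.isUnit_iff _).1
        ((LinearMap.isUnit_iff_isUnit_det _).2 hunit)).surjective
      exact this
    obtain ⟨v, hv⟩ := hsurj (x + h x)
    have h3 := DFunLike.congr_fun h2 v
    have h4 := h1 x (mem_ball_zero_iff.1 hx).le
    simp only [_root_.smul_apply, ContinuousLinearMap.comp_apply, hv, innerSL_apply_apply,
      real_inner_self_eq_norm_sq, h4, _root_.zero_apply] at h3
    norm_num at h3
  -- The volume identity passes from small times to time `1` through the affine combination,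
  -- contradicting `hzero`.
  have hfin : ∫ x in ball (0 : E) 1, (1 + fderiv ℝ h x).det = V := by
    rw [funext fun x => hsum (fderiv ℝ h x),
      integral_finsetSum _ fun i _ => (hint (t i)).const_mul (c i)]
    simp_rw [integral_const_mul, hvol]
    rw [← Finset.sum_mul, hc, one_mul]
  rw [setIntegral_congr_fun measurableSet_ball hzero] at hfin
  rw [integral_zero] at hfin
  exact hV.ne hfin

open Metric in
/-- A continuously differentiable map into the open unit ball has a fixed point in it. -/
theorem exists_fixedPoint_of_contDiff {E : Type*} [NormedAddCommGroup E]
    [InnerProductSpace ℝ E] [FiniteDimensional ℝ E] {g : E → E} (hg : ContDiff ℝ 1 g)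
    (hg1 : ∀ x, ‖g x‖ < 1) : ∃ x ∈ closedBall (0 : E) 1, g x = x := by
  by_contra! hne
  -- The retraction follows the ray from `g x` through `x` to the sphere. `D` is the reduced
  -- discriminant of `‖x + s • w x‖ ^ 2 = 1` in `s`, and the larger root is used; on the sphere `b >
  -- 0` makes that root `0`.
  set w : E → E := fun x => x - g x
  set b : E → ℝ := fun x => inner ℝ x (w x)
  set D : E → ℝ := fun x => b x ^ 2 + ‖w x‖ ^ 2 * (1 - ‖x‖ ^ 2)
  have hw : ContDiff ℝ 1 w := contDiff_id.sub hg
  have hb : ContDiff ℝ 1 b := contDiff_id.inner ℝ hw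
  have hD : ContDiff ℝ 1 D :=
    (hb.pow 2).add ((hw.norm_sq ℝ).mul (contDiff_const.sub (contDiff_id.norm_sq ℝ)))
  have hw0 : ∀ x, ‖x‖ ≤ 1 → w x ≠ 0 := fun x hx h =>
    hne x (mem_closedBall_zero_iff.2 hx) (sub_eq_zero.1 h).symm
  have hb0 : ∀ x, ‖x‖ = 1 → 0 < b x := by
    intro x hx
    have h1 : b x = 1 - inner ℝ x (g x) := by
      simp [b, w, inner_sub_right, hx]
    have h2 := real_inner_le_norm x (g x)
    rw [hx, one_mul] at h2
    linarith [hg1 x]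
  have hD0 : ∀ x, ‖x‖ ≤ 1 → 0 < D x := by
    intro x hx
    rcases hx.lt_or_eq with hx' | hx'
    · have h1 : 0 < ‖w x‖ ^ 2 := by have := norm_pos_iff.2 (hw0 x hx); positivity
      have h2 : 0 < 1 - ‖x‖ ^ 2 := by nlinarith [norm_nonneg x]
      have := mul_pos h1 h2
      have := sq_nonneg (b x)
      simp only [D]; linarith
    · have := hb0 x hx'
      simp only [D, hx']; norm_num; positivity
  refine no_contDiff_retraction (h := fun x => ((-b x + √(D x)) / ‖w x‖ ^ 2) • w x)
    (U := {x | w x ≠ 0} ∩ {x | 0 < D x}) ?_ ?_ ?_ ?_ ?_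
  · exact (isOpen_ne_fun hw.continuous continuous_const).inter
      (isOpen_lt continuous_const hD.continuous)
  · intro x hx
    rw [mem_closedBall_zero_iff] at hx
    exact ⟨hw0 x hx, hD0 x hx⟩
  · rintro x ⟨hx1, hx2⟩
    have hx1 : w x ≠ 0 := hx1
    have hx2 : 0 < D x := hx2
    refine ContDiffAt.contDiffWithinAt (ContDiffAt.smul (ContDiffAt.div ?_ ?_ ?_) hw.contDiffAt)
    · exact hb.contDiffAt.neg.add (hD.contDiffAt.sqrt hx2.ne')
    · exact (hw.norm_sq ℝ).contDiffAt
    · have := norm_pos_iff.2 hx1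
      positivity
  · intro x hx
    have : √(D x) = b x := by
      simp only [D, hx]; norm_num; exact Real.sqrt_sq (hb0 x hx).le
    simp [this]
  · intro x hx
    have h1 : ‖w x‖ ≠ 0 := norm_ne_zero_iff.2 (hw0 x hx)
    have h2 := Real.sq_sqrt (hD0 x hx).le
    set r := √(D x)
    rw [← sq_eq_sq₀ (norm_nonneg _) zero_le_one, norm_add_sq_real, inner_smul_right, norm_smul,
      mul_pow, Real.norm_eq_abs, sq_abs]
    change ‖x‖ ^ 2 + 2 * ((-b x + r) / ‖w x‖ ^ 2 * b x) + _ = _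
    simp only [D] at h2
    field_simp
    linear_combination h2

open Metric in
/-- **Brouwer's fixed point theorem**, for continuous maps of a Euclidean space into its unit
ball. -/
theorem exists_fixedPoint_of_norm_le_one {E : Type*} [NormedAddCommGroup E]
    [InnerProductSpace ℝ E] [FiniteDimensional ℝ E] {f : E → E} (hf : Continuous f)
    (hf1 : ∀ x, ‖f x‖ ≤ 1) : ∃ x, f x = x := by
  by_contra! hne
  obtain ⟨x₀, -, hmin⟩ := (isCompact_closedBall (0 : E) 1).exists_isMinOn (by simp)
    (f := fun x => ‖f x - x‖) (by fun_prop)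
  -- A smooth `ε`-approximation scaled by `(1 + ε)⁻¹` has a fixed point `x` in the ball, where `‖f x
  -- - x‖ < ε + ε * ‖x‖ ≤ 2 * ε`, below the minimum.
  set ε := ‖f x₀ - x₀‖ / 2
  have hε : 0 < ε := half_pos (norm_pos_iff.2 (sub_ne_zero.2 (hne x₀)))
  obtain ⟨g, hg, hgf, -⟩ := hf.exists_contDiff_approx 1 (ε := fun _ => ε) continuous_const
    fun _ => hε
  have hg' : ∀ x, ‖g x‖ < 1 + ε := fun x => by
    have h1 := hgf x
    rw [dist_eq_norm] at h1
    have h2 := norm_sub_norm_le (g x) (f x)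
    linarith [hf1 x]
  have hs : ∀ x, ‖(1 + ε)⁻¹ • g x‖ < 1 := fun x => by
    rw [norm_smul, norm_inv, Real.norm_of_nonneg (by positivity), inv_mul_lt_iff₀ (by positivity)]
    simpa using hg' x
  obtain ⟨x, hx, hgx⟩ := exists_fixedPoint_of_contDiff (g := fun x => (1 + ε)⁻¹ • g x)
    (contDiff_const.smul (by exact_mod_cast hg)) hs
  have h1 : g x = (1 + ε) • x := by
    conv_rhs => rw [← hgx]
    rw [smul_inv_smul₀ (by positivity)]
  have h2 := hgf x
  rw [mem_closedBall_zero_iff] at hx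
  rw [dist_eq_norm, h1, norm_sub_rev] at h2
  have h3 : ‖f x - x‖ ≤ ‖f x - (1 + ε) • x‖ + ε * ‖x‖ := by
    have e : f x - x = (f x - (1 + ε) • x) + ε • x := by rw [add_smul, one_smul]; abel
    calc ‖f x - x‖ = ‖(f x - (1 + ε) • x) + ε • x‖ := by rw [← e]
      _ ≤ _ := norm_add_le _ _
      _ = _ := by rw [norm_smul, Real.norm_of_nonneg hε.le]
  have h4 : ‖f x₀ - x₀‖ ≤ ‖f x - x‖ := hmin (mem_closedBall_zero_iff.2 hx)
  have h5 : ‖f x₀ - x₀‖ = 2 * ε := by simp only [ε]; ring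
  nlinarith

/-! ### Fixed points on the space of product policies -/

/-- A compact retract of a finite-dimensional coordinate space has the fixed point property. -/
theorem exists_fixedPoint_of_retract {X ι : Type*} [TopologicalSpace X] [CompactSpace X]
    [Fintype ι] {e : X → ι → ℝ} {p : (ι → ℝ) → X} (he : Continuous e) (hp : Continuous p)
    (hpe : ∀ x, p (e x) = x) {f : X → X} (hf : Continuous f) : ∃ x, f x = x := by
  set e' : X → EuclideanSpace ℝ ι := fun x => WithLp.toLp 2 (e x)
  set p' : EuclideanSpace ℝ ι → X := fun y => p y.ofLp
  have he' : Continuous e' := (PiLp.continuous_toLp 2 _).comp he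
  have hp' : Continuous p' := hp.comp (PiLp.continuous_ofLp 2 _)
  obtain ⟨R, hR⟩ := (isCompact_range he').isBounded.exists_pos_norm_le
  obtain ⟨hR0, hR⟩ := hR
  obtain ⟨y, hy⟩ := exists_fixedPoint_of_norm_le_one
    (f := fun y => R⁻¹ • e' (f (p' (R • y))))
    (by fun_prop) fun y => by
      rw [norm_smul, norm_inv, Real.norm_of_nonneg hR0.le, inv_mul_le_iff₀ hR0, mul_one]
      exact hR _ ⟨_, rfl⟩
  refine ⟨p' (R • y), ?_⟩
  conv_rhs => rw [← hy]
  rw [smul_inv_smul₀ hR0.ne']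
  exact (hpe _).symm

/-- A continuous retraction of the coordinate space onto the standard simplex. -/
noncomputable def simplexRetraction {J : Type*} [Fintype J] [Nonempty J] (y : J → ℝ) :
    stdSimplex ℝ J :=
  -- Take positive parts; normalize if their sum exceeds `1`, otherwise spread the deficit
  -- uniformly.
  ⟨fun j => (max (y j) 0 + max (1 - ∑ i, max (y i) 0) 0 / Fintype.card J) /
      max 1 (∑ i, max (y i) 0), by
    refine ⟨fun j => by positivity, ?_⟩
    rw [← Finset.sum_div, Finset.sum_add_distrib, Finset.sum_const, Finset.card_univ,
      nsmul_eq_mul, mul_div_cancel₀ _ (by positivity), div_eq_one_iff_eq (by positivity)]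
    rcases le_total 1 (∑ i, max (y i) 0) with h | h
    · rw [max_eq_right h, max_eq_right (by linarith), add_zero]
    · rw [max_eq_left h, max_eq_left (by linarith)]; ring⟩

theorem continuous_simplexRetraction {J : Type*} [Fintype J] [Nonempty J] :
    Continuous (simplexRetraction (J := J)) := by
  refine Continuous.subtype_mk (continuous_pi fun j => Continuous.div₀ ?_ ?_ ?_) _
  · fun_prop
  · fun_prop
  · intro y; positivity

theorem simplexRetraction_coe {J : Type*} [Fintype J] [Nonempty J] (y : stdSimplex ℝ J) :
    simplexRetraction (fun j => y j) = y := by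
  ext j
  have h : ∀ i, max (y i) 0 = y i := fun i => max_eq_left (y.2.1 i)
  have hs : ∑ i, y i = 1 := y.2.2
  change (max (y j) 0 + max (1 - ∑ i, max (y i) 0) 0 / Fintype.card J) /
      max 1 (∑ i, max (y i) 0) = y j
  simp only [h]
  simp [hs]

/-- The space of product policies has the fixed point property. -/
theorem ProductPolicy.exists_fixedPoint {N H : ℕ} {S : Type*} [Fintype S] {A : Fin N → Type*}
    [∀ i, Fintype (A i)] [∀ i, Nonempty (A i)] {f : ProductPolicy S A H → ProductPolicy S A H}
    (hf : Continuous f) : ∃ π, f π = π := by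
  refine exists_fixedPoint_of_retract (ι := Σ k : Fin N, Fin H × S × A k)
    (e := fun π i => π i.1 i.2.1 i.2.2.1 i.2.2.2)
    (p := fun y k h s => simplexRetraction (J := A k) fun a => y ⟨k, h, s, a⟩) ?_ ?_ ?_ hf
  · refine continuous_pi fun i => (continuous_apply i.2.2.2).comp (continuous_subtype_val.comp ?_)
    fun_prop
  · refine continuous_pi fun k => continuous_pi fun h => continuous_pi fun s =>
      (continuous_simplexRetraction (J := A k)).comp ?_
    fun_prop
  · intro π
    funext k h s
    exact simplexRetraction_coe (π k h s)

/-! ### Trajectory sums and state distributions -/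

section MarkovChain

variable {H : ℕ} {S X : Type*} [Fintype S] [Fintype X]

/-- The (possibly signed) distribution of the state at each step of the Markov chain with initial
distribution `μ` and transition matrices `T`. -/
noncomputable def stateDist (T : Fin H → S → S → ℝ) (μ : S → ℝ) : Fin (H + 1) → S → ℝ :=
  Fin.induction (motive := fun _ => S → ℝ) μ fun h d s' => ∑ s, d s * T h s s'

@[simp]
theorem stateDist_zero (T : Fin H → S → S → ℝ) (μ : S → ℝ) : stateDist T μ 0 = μ := rfl

theorem stateDist_succ (T : Fin H → S → S → ℝ) (μ : S → ℝ) (h : Fin H) (s' : S) :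
    stateDist T μ h.succ s' = ∑ s, stateDist T μ h.castSucc s * T h s s' := rfl

/-- `stateDist` grows at the last step, while induction on the horizon peels off the first. -/
theorem stateDist_succ_eq_tail (T : Fin (H + 1) → S → S → ℝ) (μ : S → ℝ) (h : Fin (H + 1)) :
    stateDist T μ h.succ =
      stateDist (fun h => T h.succ) (fun s' => ∑ s, μ s * T 0 s s') h := by
  induction h using Fin.induction with
  | zero => rfl
  | succ i ih =>
    funext s'
    rw [stateDist_succ, stateDist_succ, ← ih]
    rfl

theorem stateDist_nonneg {T : Fin H → S → S → ℝ} {μ : S → ℝ} (hT : ∀ h s s', 0 ≤ T h s s')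
    (hμ : ∀ s, 0 ≤ μ s) (h : Fin (H + 1)) (s : S) : 0 ≤ stateDist T μ h s := by
  induction h using Fin.induction generalizing s with
  | zero => exact hμ s
  | succ i ih => exact Finset.sum_nonneg fun s' _ => mul_nonneg (ih s') (hT _ _ _)

theorem continuous_stateDist {Y : Type*} [TopologicalSpace Y] {T : Y → Fin H → S → S → ℝ}
    (hT : ∀ h s s', Continuous fun y => T y h s s') (μ : S → ℝ) (h : Fin (H + 1)) (s : S) :
    Continuous fun y => stateDist (T y) μ h s := by
  induction h using Fin.induction generalizing s with
  | zero => exact continuous_const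
  | succ i ih => exact continuous_finsetSum _ fun s' _ => (ih s').mul (hT _ _ _)

/-- A chain whose transitions mix those of other chains, in proportion to their occupancies,
has the mixed occupancies. -/
theorem stateDist_eq_sum {J : Type*} [Fintype J] {T : Fin H → S → S → ℝ}
    {T' : J → Fin H → S → S → ℝ} {μ : S → ℝ} {c : J → ℝ} (hc : ∑ j, c j = 1)
    (hT : ∀ h s s', (∑ j, c j * stateDist (T' j) μ h.castSucc s) * T h s s' =
      ∑ j, c j * stateDist (T' j) μ h.castSucc s * T' j h s s') (h : Fin (H + 1)) (s : S) :
    stateDist T μ h s = ∑ j, c j * stateDist (T' j) μ h s := by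
  induction h using Fin.induction generalizing s with
  | zero => simp [← Finset.sum_mul, hc]
  | succ i ih =>
    simp_rw [stateDist_succ, ih, hT, Finset.mul_sum]
    rw [Finset.sum_comm]
    simp_rw [mul_assoc]

/-- The weight of a trajectory with states `σ` and actions `α`. -/
noncomputable def pathWeight (q : Fin H → S → X → S → ℝ) (μ : S → ℝ) (σ : Fin (H + 1) → S)
    (α : Fin H → X) : ℝ :=
  μ (σ 0) * ∏ h : Fin H, q h (σ h.castSucc) (α h) (σ h.succ)

-- The first step is absorbed into the initial weights, which is why `μ` need not be a probability.
omit [Fintype S] [Fintype X] in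
theorem pathWeight_cons (q : Fin (H + 1) → S → X → S → ℝ) (μ : S → ℝ) (s : S)
    (σ : Fin (H + 1) → S) (a : X) (α : Fin H → X) :
    pathWeight q μ (Fin.cons s σ : Fin (H + 2) → S) (Fin.cons a α : Fin (H + 1) → X) =
      pathWeight (fun h => q h.succ) (fun s' => μ s * q 0 s a s') σ α := by
  simp only [pathWeight, Fin.prod_univ_succ, mul_assoc]
  rfl

theorem Fin.sum_pi_succ {n : ℕ} (F : (Fin (n + 1) → X) → ℝ) :
    ∑ σ, F σ = ∑ x, ∑ σ : Fin n → X, F (Fin.cons x σ) := by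
  rw [← Fintype.sum_prod_type', ← (Fin.consEquiv fun _ : Fin (n + 1) => X).sum_comp]
  rfl

theorem sum_paths_succ (F : (Fin (H + 2) → S) → (Fin (H + 1) → X) → ℝ) :
    ∑ σ, ∑ α, F σ α = ∑ s, ∑ a, ∑ σ : Fin (H + 1) → S, ∑ α : Fin H → X,
      F (Fin.cons s σ) (Fin.cons a α) := by
  rw [Fin.sum_pi_succ]
  refine Finset.sum_congr rfl fun s _ => ?_
  simp_rw [Fin.sum_pi_succ (X := X)]
  exact Finset.sum_comm

theorem sum_pathWeight {q : Fin H → S → X → S → ℝ} (hq : ∀ h s, ∑ a, ∑ s', q h s a s' = 1)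
    (μ : S → ℝ) : ∑ σ, ∑ α, pathWeight q μ σ α = ∑ s, μ s := by
  induction H generalizing μ with
  | zero =>
    rw [Fin.sum_pi_succ]
    simp [pathWeight]
  | succ H ih =>
    rw [sum_paths_succ]
    simp_rw [pathWeight_cons, ih fun h => hq h.succ, ← Finset.mul_sum, hq, mul_one]

theorem sum_comm_pairs {W Z : Type*} [Fintype W] [Fintype Z] (F : S → X → W → Z → ℝ) :
    ∑ s, ∑ a, ∑ w, ∑ z, F s a w z = ∑ w, ∑ z, ∑ s, ∑ a, F s a w z := by
  calc _ = ∑ p : S × X, ∑ t : W × Z, F p.1 p.2 t.1 t.2 := by simp only [Fintype.sum_prod_type]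
    _ = ∑ t : W × Z, ∑ p : S × X, F p.1 p.2 t.1 t.2 := Finset.sum_comm
    _ = _ := by simp only [Fintype.sum_prod_type]

/-- The expected total reward in terms of the state distributions. -/
theorem sum_pathWeight_mul_sum {q : Fin H → S → X → S → ℝ}
    (hq : ∀ h s, ∑ a, ∑ s', q h s a s' = 1) (μ : S → ℝ) (r : Fin H → S → X → ℝ) :
    ∑ σ, ∑ α, pathWeight q μ σ α * ∑ h, r h (σ h.castSucc) (α h) =
      ∑ h : Fin H, ∑ s, stateDist (fun h s s' => ∑ a, q h s a s') μ h.castSucc s *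
        ∑ a, (∑ s', q h s a s') * r h s a := by
  induction H generalizing μ with
  | zero => simp
  | succ H ih =>
    have e : ∀ (s : S) (a : X) (σ : Fin (H + 1) → S) (α : Fin H → X),
        ∑ h, r h ((Fin.cons s σ : Fin (H + 2) → S) h.castSucc)
          ((Fin.cons a α : Fin (H + 1) → X) h) =
        r 0 s a + ∑ h : Fin H, r h.succ (σ h.castSucc) (α h) := by
      intro s a σ α
      rw [Fin.sum_univ_succ]
      rfl
    -- Path weights are linear in the initial weights, so all first steps merge into one tail chain.
    have hlin : ∀ (σ : Fin (H + 1) → S) (α : Fin H → X),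
        pathWeight (fun h => q h.succ) (fun s' => ∑ s, μ s * ∑ a, q 0 s a s') σ α =
          ∑ s, ∑ a, pathWeight (fun h => q h.succ) (fun s' => μ s * q 0 s a s') σ α := by
      intro σ α
      simp only [pathWeight, Finset.mul_sum, Finset.sum_mul]
    rw [sum_paths_succ, Fin.sum_univ_succ]
    simp_rw [pathWeight_cons, e, mul_add, Finset.sum_add_distrib]
    congr 1
    · refine Finset.sum_congr rfl fun s _ => ?_
      rw [Finset.mul_sum]
      refine Finset.sum_congr rfl fun a _ => ?_
      simp_rw [← Finset.sum_mul]
      rw [sum_pathWeight fun h => hq h.succ, ← Finset.mul_sum, mul_assoc]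
      rfl
    · simp_rw [← Fin.succ_castSucc, stateDist_succ_eq_tail]
      refine Eq.trans ?_ (ih (fun h => hq h.succ) (fun s' => ∑ s, μ s * ∑ a, q 0 s a s')
        fun h => r h.succ)
      simp_rw [hlin, Finset.sum_mul]
      exact sum_comm_pairs _

end MarkovChain

/-! ### Values, visit probabilities and mixtures -/

section Game

variable {N H : ℕ} {S : Type u} [Fintype S] {A : Fin N → Type v} [∀ i, Fintype (A i)]

omit [Fintype S] in
theorem jointProb_nonneg (π : ProductPolicy S A H) (h : Fin H) (s : S) (a : JointAction A) :
    0 ≤ jointProb π h s a :=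
  Finset.prod_nonneg fun i _ => (π i h s).2.1 (a i)

omit [Fintype S] in
theorem sum_jointProb (π : ProductPolicy S A H) (h : Fin H) (s : S) :
    ∑ a, jointProb π h s a = 1 := by
  have := Finset.prod_univ_sum (fun i => (Finset.univ : Finset (A i))) fun i b => π i h s b
  rw [Fintype.piFinset_univ] at this
  simp only [jointProb]
  rw [← this]
  exact Finset.prod_eq_one fun i _ => (π i h s).2.2

omit [Fintype S] in
/-- The probability of a joint action is linear in the policy of agent `k`. -/
theorem jointProb_update (π : ProductPolicy S A H) (k : Fin N) (ρ : AgentPolicy S (A k) H)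
    (h : Fin H) (s : S) (a : JointAction A) :
    jointProb (Function.update π k ρ) h s a =
      ρ h s (a k) * ∏ i ∈ Finset.univ.erase k, π i h s (a i) := by
  rw [jointProb, ← Finset.mul_prod_erase _ _ (Finset.mem_univ k), Function.update_self]
  congr 1
  refine Finset.prod_congr rfl fun i hi => ?_
  rw [Function.update_of_ne (Finset.ne_of_mem_erase hi)]

/-- The transition matrix between states under a product policy. -/
noncomputable def stateKernel (P : TransitionKernel S A H) (π : ProductPolicy S A H) (h : Fin H)
    (s s' : S) : ℝ :=
  ∑ a, jointProb π h s a * P h s a s'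

theorem stateKernel_nonneg (P : TransitionKernel S A H) (π : ProductPolicy S A H) (h : Fin H)
    (s s' : S) : 0 ≤ stateKernel P π h s s' :=
  Finset.sum_nonneg fun a _ => mul_nonneg (jointProb_nonneg π h s a) ((P h s a).2.1 s')

open Classical in
/-- The probability that play from `s₁` visits a state at a step. -/
noncomputable def visitProb (P : TransitionKernel S A H) (π : ProductPolicy S A H) (s₁ : S) :
    Fin (H + 1) → S → ℝ :=
  stateDist (stateKernel P π) fun s => if s = s₁ then 1 else 0

theorem visitProb_nonneg (P : TransitionKernel S A H) (π : ProductPolicy S A H) (s₁ : S)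
    (h : Fin (H + 1)) (s : S) : 0 ≤ visitProb P π s₁ h s :=
  stateDist_nonneg (stateKernel_nonneg P π) (fun s => by split_ifs <;> norm_num) h s

/-- The value as the expectation of the stage rewards under the visit probabilities. -/
theorem value_eq_sum_visitProb (P : TransitionKernel S A H) (π : ProductPolicy S A H) (s₁ : S)
    (r : Fin H → S → JointAction A → ℝ) :
    value P π s₁ r = ∑ h : Fin H, ∑ s, visitProb P π s₁ h.castSucc s *
      ∑ a, jointProb π h s a * r h s a := by
  classical
  have hP : ∀ h s a, ∑ s', jointProb π h s a * P h s a s' = jointProb π h s a := by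
    intro h s a
    rw [← Finset.mul_sum, show ∑ s', P h s a s' = 1 from (P h s a).2.2, mul_one]
  have := sum_pathWeight_mul_sum (q := fun h s a s' => jointProb π h s a * P h s a s')
    (fun h s => by simp_rw [hP, sum_jointProb]) (fun s => if s = s₁ then 1 else 0) r
  simp_rw [hP] at this
  convert this using 1
  simp only [value, trajProb, pathWeight]
  congr!

omit [Fintype S] in
theorem continuous_apply_policy (i : Fin N) (h : Fin H) (s : S) (b : A i) :
    Continuous fun π : ProductPolicy S A H => π i h s b :=
  (continuous_apply b).comp (continuous_subtype_val.comp
    ((continuous_apply s).comp ((continuous_apply h).comp (continuous_apply i))))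

omit [Fintype S] in
theorem continuous_jointProb (h : Fin H) (s : S) (a : JointAction A) :
    Continuous fun π : ProductPolicy S A H => jointProb π h s a :=
  continuous_finsetProd _ fun i _ => continuous_apply_policy i h s (a i)

theorem continuous_visitProb (P : TransitionKernel S A H) (s₁ : S) (h : Fin (H + 1)) (s : S) :
    Continuous fun π : ProductPolicy S A H => visitProb P π s₁ h s :=
  continuous_stateDist (fun h s _ => continuous_finsetSum _ fun a _ =>
    (continuous_jointProb h s a).mul continuous_const) _ h s

theorem continuous_value (P : TransitionKernel S A H) (s₁ : S)
    (r : Fin H → S → JointAction A → ℝ) :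
    Continuous fun π : ProductPolicy S A H => value P π s₁ r := by
  simp_rw [value_eq_sum_visitProb]
  exact continuous_finsetSum _ fun h _ => continuous_finsetSum _ fun s _ =>
    (continuous_visitProb P s₁ _ s).mul (continuous_finsetSum _ fun a _ =>
      (continuous_jointProb h s a).mul continuous_const)

/-- If the policy of agent `k` mixes the policies `ρ j` in proportion to the weighted visit
probabilities, then its value is the weighted mean of the values of the `ρ j`. -/
theorem value_eq_sum_of_mix {J : Type*} [Fintype J] (P : TransitionKernel S A H)
    (π : ProductPolicy S A H) (s₁ : S) (k : Fin N) (ρ : J → AgentPolicy S (A k) H) {c : J → ℝ}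
    (hc : ∑ j, c j = 1)
    (hπ : ∀ (h : Fin H) s b,
      (∑ j, c j * visitProb P (Function.update π k (ρ j)) s₁ h.castSucc s) * π k h s b =
        ∑ j, c j * visitProb P (Function.update π k (ρ j)) s₁ h.castSucc s * ρ j h s b)
    (r : Fin H → S → JointAction A → ℝ) :
    value P π s₁ r = ∑ j, c j * value P (Function.update π k (ρ j)) s₁ r := by
  -- Needed twice: with transition probabilities as `F` for the visits, and with the reward for the
  -- value.
  have hlin : ∀ (h : Fin H) (s : S) (F : JointAction A → ℝ),
      (∑ j, c j * visitProb P (Function.update π k (ρ j)) s₁ h.castSucc s) *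
          ∑ a, jointProb π h s a * F a =
        ∑ j, c j * visitProb P (Function.update π k (ρ j)) s₁ h.castSucc s *
          ∑ a, jointProb (Function.update π k (ρ j)) h s a * F a := by
    intro h s F
    have e : ∀ a, jointProb π h s a =
        π k h s (a k) * ∏ i ∈ Finset.univ.erase k, π i h s (a i) := fun a => by
      rw [← jointProb_update, Function.update_eq_self]
    simp_rw [e, jointProb_update]
    rw [Finset.mul_sum]
    simp_rw [← mul_assoc, hπ, Finset.sum_mul, Finset.mul_sum]
    rw [Finset.sum_comm]
    simp_rw [← mul_assoc]
  have hvisit : ∀ (h : Fin (H + 1)) (s : S), visitProb P π s₁ h s =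
      ∑ j, c j * visitProb P (Function.update π k (ρ j)) s₁ h s :=
    fun h s => stateDist_eq_sum hc (fun h s s' => hlin h s fun a => P h s a s') h s
  have hsum : ∀ F : J → Fin H → S → ℝ,
      ∑ j, c j * ∑ h, ∑ s, F j h s = ∑ h, ∑ s, ∑ j, c j * F j h s := by
    intro F
    simp only [Finset.mul_sum]
    rw [Finset.sum_comm]
    exact Finset.sum_congr rfl fun h _ => Finset.sum_comm
  simp_rw [value_eq_sum_visitProb, hvisit, hlin, hsum, mul_assoc]

/-! ### Nash's map and existence of equilibria -/

/-- The vector value for a family of scalar rewards. -/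
noncomputable def familyValue {M : ℕ} (P : TransitionKernel S A H) (s₁ : S)
    (r : Fin H → S → JointAction A → Fin M → ℝ) (π : ProductPolicy S A H) : Fin M → ℝ :=
  fun m => value P π s₁ fun h s a => r h s a m

/-- One step of the Nash map for agent `k`: the policy moves towards the policies `ρ j` in
proportion to their gains `w j` and to their visit probabilities `d j`. -/
noncomputable def nashStep {J B : Type*} [Fintype J] [Fintype B] (π : AgentPolicy S B H)
    (ρ : J → AgentPolicy S B H) (w : J → ℝ) (hw : ∀ j, 0 ≤ w j) (d : J → Fin H → S → ℝ)
    (hd : ∀ j h s, 0 ≤ d j h s) : AgentPolicy S B H := fun h s =>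
  ⟨fun b => (π h s b + ∑ j, w j * d j h s * ρ j h s b) / (1 + ∑ j, w j * d j h s), by
    have h0 : 0 ≤ ∑ j, w j * d j h s :=
      Finset.sum_nonneg fun j _ => mul_nonneg (hw j) (hd j h s)
    refine ⟨fun b => div_nonneg (add_nonneg ((π h s).2.1 b) (Finset.sum_nonneg fun j _ =>
      mul_nonneg (mul_nonneg (hw j) (hd j h s)) ((ρ j h s).2.1 b))) (by positivity), ?_⟩
    rw [← Finset.sum_div, div_eq_one_iff_eq (by positivity), Finset.sum_add_distrib,
      Finset.sum_comm]
    congr 1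
    · exact (π h s).2.2
    · refine Finset.sum_congr rfl fun j _ => ?_
      rw [← Finset.mul_sum, show ∑ b, ρ j h s b = 1 from (ρ j h s).2.2, mul_one]⟩

omit [Fintype S] in
theorem nashStep_apply {J B : Type*} [Fintype J] [Fintype B] (π : AgentPolicy S B H)
    (ρ : J → AgentPolicy S B H) (w : J → ℝ) (hw : ∀ j, 0 ≤ w j) (d : J → Fin H → S → ℝ)
    (hd : ∀ j h s, 0 ≤ d j h s) (h : Fin H) (s : S) (b : B) :
    nashStep π ρ w hw d hd h s b =
      (π h s b + ∑ j, w j * d j h s * ρ j h s b) / (1 + ∑ j, w j * d j h s) := rfl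

/-- At a fixed point of the Nash map no agent gains from finitely many given deviations. -/
theorem exists_forall_update_le_of_fintype [∀ i, Nonempty (A i)] {M : ℕ} {J : Type*} [Fintype J]
    (P : TransitionKernel S A H) (s₁ : S) (r : Fin N → Fin H → S → JointAction A → Fin M → ℝ)
    {u : Fin N → (Fin M → ℝ) → ℝ} (hu : ∀ k, Continuous (u k))
    (hq : ∀ k, QuasiconcaveOn ℝ Set.univ (u k)) (ρ : J → ProductPolicy S A H) :
    ∃ π : ProductPolicy S A H, ∀ k j,
      u k (familyValue P s₁ (r k) (Function.update π k (ρ j k))) ≤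
        u k (familyValue P s₁ (r k) π) := by
  set U : Fin N → ProductPolicy S A H → ℝ := fun k π => u k (familyValue P s₁ (r k) π)
  have hU : ∀ k, Continuous (U k) := fun k =>
    (hu k).comp (continuous_pi fun m => continuous_value P s₁ _)
  set dev : Fin N → J → ProductPolicy S A H → ProductPolicy S A H :=
    fun k j π => Function.update π k (ρ j k)
  have hdev : ∀ k j, Continuous (dev k j) := fun k j =>
    continuous_id.update k continuous_const
  set w : Fin N → J → ProductPolicy S A H → ℝ := fun k j π => max (U k (dev k j π) - U k π) 0
  have hw : ∀ k j, Continuous (w k j) := fun k j =>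
    (((hU k).comp (hdev k j)).sub (hU k)).max continuous_const
  set d : Fin N → J → ProductPolicy S A H → Fin H → S → ℝ :=
    fun k j π h s => visitProb P (dev k j π) s₁ h.castSucc s
  have hd : ∀ k j h s, Continuous fun π => d k j π h s := fun k j h s =>
    (continuous_visitProb P s₁ h.castSucc s).comp (hdev k j)
  have hw0 : ∀ k j π, 0 ≤ w k j π := fun k j π => le_max_right _ _
  have hd0 : ∀ k j π h s, 0 ≤ d k j π h s := fun k j π h s => visitProb_nonneg _ _ _ _ _
  obtain ⟨π, hπ⟩ := ProductPolicy.exists_fixedPoint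
    (f := fun π k => nashStep (π k) (fun j => ρ j k) (fun j => w k j π) (fun j => hw0 k j π)
      (fun j => d k j π) fun j => hd0 k j π) (by
    refine continuous_pi fun k => continuous_pi fun h => continuous_pi fun s =>
      Continuous.subtype_mk (continuous_pi fun b => Continuous.div₀ ?_ ?_ fun π => ?_) _
    · exact (continuous_apply_policy k h s b).add (continuous_finsetSum _ fun j _ =>
        ((hw k j).mul (hd k j h s)).mul continuous_const)
    · exact continuous_const.add (continuous_finsetSum _ fun j _ => (hw k j).mul (hd k j h s))
    · have : 0 ≤ ∑ j, w k j π * d k j π h s :=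
        Finset.sum_nonneg fun j _ => mul_nonneg (hw0 k j π) (hd0 k j π h s)
      positivity)
  -- Clearing denominators leaves the mixing identity, which also holds where all weights vanish.
  have hfix : ∀ k h s b, (∑ j, w k j π * d k j π h s) * π k h s b =
      ∑ j, w k j π * d k j π h s * ρ j k h s b := by
    intro k h s b
    have h0 : 0 ≤ ∑ j, w k j π * d k j π h s :=
      Finset.sum_nonneg fun j _ => mul_nonneg (hw0 k j π) (hd0 k j π h s)
    have h1 := DFunLike.congr_fun (congrFun (congrFun (congrFun hπ k) h) s) b
    rw [nashStep_apply, div_eq_iff (by positivity)] at h1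
    linarith
  refine ⟨π, fun k j => ?_⟩
  by_contra! hj
  set W := ∑ i, w k i π
  have hW : 0 < W := Finset.sum_pos' (fun i _ => hw0 k i π)
    ⟨j, Finset.mem_univ j, lt_max_of_lt_left (sub_pos.2 hj)⟩
  have hc1 : ∑ i, w k i π / W = 1 := by rw [← Finset.sum_div, div_self hW.ne']
  have hV : familyValue P s₁ (r k) π =
      ∑ i ∈ Finset.univ.filter (fun i => 0 < w k i π), (w k i π / W) •
        familyValue P s₁ (r k) (dev k i π) := by
    -- Only deviations with positive gain carry weight; their values lie in the strict superlevel
    -- set.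
    rw [Finset.sum_filter_of_ne]
    · funext m
      rw [Finset.sum_apply]
      refine value_eq_sum_of_mix P π s₁ k (fun i => ρ i k) hc1 (fun h s b => ?_) _
      have := congrArg (· / W) (hfix k h s b)
      simp only [Finset.sum_mul, Finset.sum_div] at this
      rw [Finset.sum_mul]
      convert this using 2 <;> simp only [d, dev] <;> ring
    · intro i _ hi
      refine (hw0 k i π).lt_of_ne fun h => hi ?_
      rw [← h, zero_div, zero_smul]
  have hmem : familyValue P s₁ (r k) π ∈ {v ∈ Set.univ | U k π < u k v} := by
    rw [hV]
    refine (hq k).convex_gt (U k π) |>.sum_mem (fun i _ => div_nonneg (hw0 k i π) hW.le) ?_ ?_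
    · rw [Finset.sum_filter_of_ne, hc1]
      intro i _ hi
      refine (hw0 k i π).lt_of_ne fun h => hi ?_
      rw [← h, zero_div]
    · intro i hi
      have hi := (Finset.mem_filter.1 hi).2
      refine ⟨Set.mem_univ _, ?_⟩
      rcases lt_max_iff.1 hi with h | h
      · exact sub_pos.1 h
      · exact absurd h (lt_irrefl _)
  exact lt_irrefl _ hmem.2

/-- Existence of an equilibrium for continuous quasi-concave utilities of the vector value. -/
theorem exists_forall_update_le [∀ i, Nonempty (A i)] {M : ℕ}
    (P : TransitionKernel S A H) (s₁ : S) (r : Fin N → Fin H → S → JointAction A → Fin M → ℝ)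
    {u : Fin N → (Fin M → ℝ) → ℝ} (hu : ∀ k, Continuous (u k))
    (hq : ∀ k, QuasiconcaveOn ℝ Set.univ (u k)) :
    ∃ π : ProductPolicy S A H, ∀ k (πk : AgentPolicy S (A k) H),
      u k (familyValue P s₁ (r k) (Function.update π k πk)) ≤
        u k (familyValue P s₁ (r k) π) := by
  have hU : ∀ k, Continuous fun π : ProductPolicy S A H => u k (familyValue P s₁ (r k) π) :=
    fun k => (hu k).comp (continuous_pi fun m => continuous_value P s₁ _)
  -- Each deviation profile `ρ` defines a closed condition on `π`, and any finitely many are jointly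
  -- satisfiable.
  obtain ⟨π, hπ⟩ := CompactSpace.iInter_nonempty
    (t := fun ρ : ProductPolicy S A H => {π : ProductPolicy S A H | ∀ k,
      u k (familyValue P s₁ (r k) (Function.update π k (ρ k))) ≤
        u k (familyValue P s₁ (r k) π)})
    (fun ρ => by
      simp only [Set.ofPred_forall]
      exact isClosed_iInter fun k => isClosed_le
        ((hU k).comp (continuous_id.update k continuous_const)) (hU k))
    (fun F => by
      obtain ⟨π, hπ⟩ := exists_forall_update_le_of_fintype P s₁ r hu hq
        (fun ρ : F => (ρ : ProductPolicy S A H))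
      exact ⟨π, Set.mem_iInter₂.2 fun ρ hρ k => hπ k ⟨ρ, hρ⟩⟩)
  refine ⟨π, fun k πk => ?_⟩
  have := Set.mem_iInter.1 hπ (Function.update π k πk) k
  rwa [Function.update_self] at this

end Game

/-! ### A game without SER-NE -/

/-- Two agents with two actions each and one step; both agents receive as reward vector the
indicators of the event that each agent plays `true`. -/
noncomputable def coordinationGame : MOMG 2 Unit (fun _ => Bool) 2 1 where
  P := fun _ _ _ => ⟨fun _ => 1, fun _ => zero_le_one, by simp⟩
  r := fun _ _ _ a m => if a m = true then 1 else 0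
  r_mem := fun _ _ _ a m => by split_ifs <;> simp

theorem coordinationGame_vectorValue (k m : Fin 2)
    (π : ProductPolicy Unit (fun _ : Fin 2 => Bool) 1) :
    coordinationGame.vectorValue k π () m = π m 0 () true := by
  have hsum : ∀ i, π i 0 () true + π i 0 () false = 1 := fun i => by
    rw [← Fintype.sum_bool]
    exact (π i 0 ()).2.2
  simp only [MOMG.vectorValue, value_eq_sum_visitProb, Fintype.sum_unique,
    Fin.sum_pi_succ, Fintype.sum_bool, coordinationGame, jointProb, Fin.prod_univ_two]
  simp only [visitProb, Fin.castSucc_zero, stateDist_zero, Fin.default_eq_zero,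
    PUnit.default_eq_unit, if_true, one_mul, mul_ite, mul_one, mul_zero]
  fin_cases m
  · simp
    linear_combination π 0 0 () true * hsum 1
  · simp
    linear_combination π 1 0 () true * hsum 0

/-- One agent wants to be far from the other, who wants to be close. -/
theorem coordinationGame_not_isSERNE (π : ProductPolicy Unit (fun _ : Fin 2 => Bool) 1) :
    ¬ coordinationGame.IsSERNE (fun k v => if k = 0 then (v 0 - v 1) ^ 2 else -(v 0 - v 1) ^ 2)
      () π := by
  intro hπ
  -- By copying agent `0`, agent `1` reaches distance zero, so the two marginals agree at
  -- equilibrium.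
  have h1 := hπ 1 (π 0)
  simp only [coordinationGame_vectorValue] at h1
  simp at h1
  have hv : ∀ b : Bool, ∃ q : AgentPolicy Unit Bool 1, q 0 () true = if b then 1 else 0 :=
    fun b => ⟨fun _ _ => ⟨Pi.single b 1, single_mem_stdSimplex ℝ b⟩, by cases b <;> rfl⟩
  obtain ⟨q0, hq0⟩ := hv false
  obtain ⟨q1, hq1⟩ := hv true
  -- Agent `0` then has payoff zero, but moving to one of the endpoints `0` or `1` gives a positive
  -- distance.
  have h2 := hπ 0 q0
  have h3 := hπ 0 q1
  simp only [coordinationGame_vectorValue] at h2 h3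
  simp [hq0, hq1] at h2 h3
  rw [h1] at h2 h3
  nlinarith

/-! ### The three claims -/

theorem mainTheorem9 :
    -- An ESR-NE always exists, for arbitrary utility functions.
    (∀ (N M H : ℕ) (S : Type u) [Fintype S] (A : Fin N → Type v) [∀ i, Fintype (A i)]
        [∀ i, Nonempty (A i)] (G : MOMG N S A M H) (s₁ : S) (u : Fin N → (Fin M → ℝ) → ℝ),
        ∃ π : ProductPolicy S A H, G.IsESRNE u s₁ π) ∧
    -- An SER-NE may fail to exist, even if all the utility functions are continuous.
    (∃ (N M H : ℕ) (S : Type) (_ : Fintype S) (A : Fin N → Type) (_ : ∀ i, Fintype (A i))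
        (_ : ∀ i, Nonempty (A i)) (G : MOMG N S A M H) (s₁ : S) (u : Fin N → (Fin M → ℝ) → ℝ),
        (∀ k, Continuous (u k)) ∧ ¬ ∃ π : ProductPolicy S A H, G.IsSERNE u s₁ π) ∧
    -- An SER-NE exists if all the utility functions are continuous and quasi-concave.
    (∀ (N M H : ℕ) (S : Type u) [Fintype S] (A : Fin N → Type v) [∀ i, Fintype (A i)]
        [∀ i, Nonempty (A i)] (G : MOMG N S A M H) (s₁ : S) (u : Fin N → (Fin M → ℝ) → ℝ),
        (∀ k, Continuous (u k)) → (∀ k, QuasiconcaveOn ℝ Set.univ (u k)) →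
        ∃ π : ProductPolicy S A H, G.IsSERNE u s₁ π) := by
  refine ⟨fun N M H S _ A _ _ G s₁ u => ?_, ?_, fun N M H S _ A _ _ G s₁ u hu hq => ?_⟩
  -- The scalarized reward is a single objective, valued by the coordinate map; `u` acts only on
  -- rewards, so it needs no regularity.
  · exact exists_forall_update_le (M := 1) G.P s₁ (fun k h s a _ => u k (G.r k h s a))
      (u := fun _ v => v 0) (fun _ => continuous_apply 0)
      fun _ => ((LinearMap.proj 0 : (Fin 1 → ℝ) →ₗ[ℝ] ℝ).concaveOn convex_univ).quasiconcaveOn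
  · refine ⟨2, 2, 1, Unit, inferInstance, fun _ => Bool, inferInstance, inferInstance,
      coordinationGame, (), fun k v => if k = 0 then (v 0 - v 1) ^ 2 else -(v 0 - v 1) ^ 2,
      fun k => ?_, fun ⟨π, hπ⟩ => coordinationGame_not_isSERNE π hπ⟩
    by_cases hk : k = 0 <;> simp only [hk, if_true, if_false] <;> fun_prop
  · exact exists_forall_update_le G.P s₁ G.r hu hq
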